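/- Let $M$ be a smooth (finite-dimensional, Hausdorff) manifold without boundary, $g$ a Riemannian metric on $M$ with Levi-Civita connection $\nabla^{LC}$ (acting on vector fields and, dually, on $1$-forms), and $H'\in\Omega^3(M)$. Let $E=TM\oplus T^*M$ with the anchor $\rho(X+\xi)=X$, the pairing $\langle X+\xi,Y+\eta\rangle=\eta(X)+\xi(Y)$ and the $H'$-twisted Dorfman bracket $$[X+\xi,Y+\eta]_D^{H'}=[X,Y]+\mathcal L_X\eta-i_Y d\xi-H'(X,Y,\cdot).$$ (When $H'$ is closed this is a Courant algebroid; closedness is not needed below.) A Courant algebroid connection on $E$ is an $\mathbb R$-bilinear map $\widehat\nabla:\Gamma(E)\times\Gamma(E)\to\Gamma(E)$ such that $\widehat\nabla_{fe}e'=f\widehat\nabla_ee'$, $\widehat\nabla_e(fe')=f\widehat\nabla_ee'+(\rho(e).f)e'$ and $\rho(e).\langle e',e''\rangle=\langle\widehat\nabla_ee',e''\rangle+\langle e',\widehat\nabla_ee''\rangle$ for all $f\in C^\infty(M)$, $e,e',e''\in\Gamma(E)$. Its torsion is $$\widehat T(e,e')=\widehat\nabla_ee'-\widehat\nabla_{e'}e-[e,e']_D^{H'}+\sum_\lambda\langle\widehat\nabla_{e_\lambda}e,e'\rangle\,g_E^{-1}(e^\lambda),$$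 where $(e_\lambda)$ is an arbitrary local frame of $E$, $(e^\lambda)$ the dual frame of $E^*$ and $g_E:E\to E^*$ the isomorphism given by the pairing. It is compatible with $\mathcal G_E=\mathrm{BlockDiag}(g,g^{-1})$, i.e. $\mathcal G_E(X+\xi,Y+\eta)=g(X,Y)+g^{-1}(\xi,\eta)$, if $\rho(e).\mathcal G_E(e',e'')=\mathcal G_E(\widehat\nabla_ee',e'')+\mathcal G_E(e',\widehat\nabla_ee'')$ for all $e,e',e''$. It is a Levi-Civita connection with respect to $\mathcal G_E$ and $[\cdot,\cdot]_D^{H'}$ if $\widehat T=0$ and it is compatible with $\mathcal G_E$. **Theorem.** A Courant algebroid connection $\widehat\nabla$ on $E$ is a Levi-Civita connection with respect to $\mathcal G_E$ and $[\cdot,\cdot]_D^{H'}$ if and only if there are tensor fields $K\in\Omega^1(M)\otimes\Omega^2(M)$ and $J\in\mathfrak X(M)\otimes\mathfrak X^2(M)$ ($K(X,Y,Z)$ and $J(\xi,\eta,\zeta)$ are skew-symmetric in the last two arguments) whose total skew-symmetrizations vanish, $K_a=0$ and $J_a=0$, such that for all vector fields $X,Z$ and $1$-forms $\xi,\zeta$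 $$\begin{aligned} \widehat\nabla_X(Z+\zeta)={}&\nabla^{LC}_XZ+g^{-1}K(X,Z,\cdot)-\tfrac13g^{-1}H'(X,g^{-1}(\zeta),\cdot)-J(g(X),\zeta,\cdot)\\ &-\tfrac13H'(X,Z,\cdot)-gJ(g(X),g(Z),\cdot)+\nabla^{LC}_X\zeta+K(X,g^{-1}(\zeta),\cdot),\\ \widehat\nabla_\xi(Z+\zeta)={}&\tfrac16g^{-1}H'(g^{-1}(\xi),Z,\cdot)-J(\xi,g(Z),\cdot)+g^{-1}K(g^{-1}(\xi),g^{-1}(\zeta),\cdot)\\ &+K(g^{-1}(\xi),Z,\cdot)+\tfrac16H'(g^{-1}(\xi),g^{-1}(\zeta),\cdot)-gJ(\xi,\zeta,\cdot), \end{aligned}$$ where in each formula the first line is the component in $TM$ and the second line the component in $T^*M$. -/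

import Mathlib

open Bundle
open scoped Manifold ContDiff

noncomputable section

namespace Courant

section Defs

set_option linter.unusedSectionVars false

/-! Throughout, `M` is a smooth manifold without boundary, modelled on a finite-dimensional real
vector space `E`. -/

variable {E : Type*} [NormedAddCommGroup E] [NormedSpace ℝ E] [FiniteDimensional ℝ E]
  {M : Type*} [TopologicalSpace M] [ChartedSpace E M] [IsManifold 𝓘(ℝ, E) ∞ M]

/-! ### Vector fields, one-forms and sections of `TM ⊕ T*M` -/

/-- The tangent space `T_x M`. -/
abbrev Tan (E : Type*) [NormedAddCommGroup E] [NormedSpace ℝ E]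
    {M : Type*} [TopologicalSpace M] [ChartedSpace E M] (x : M) : Type _ :=
  TangentSpace 𝓘(ℝ, E) x

/-- The cotangent space `T*_x M`. -/
abbrev Cot (E : Type*) [NormedAddCommGroup E] [NormedSpace ℝ E]
    {M : Type*} [TopologicalSpace M] [ChartedSpace E M] (x : M) : Type _ :=
  TangentSpace 𝓘(ℝ, E) x →L[ℝ] ℝ

instance instFiniteDimensionalTan (x : M) : FiniteDimensional ℝ (TangentSpace 𝓘(ℝ, E) x) :=
  inferInstanceAs (FiniteDimensional ℝ E)

instance instT2SpaceTan (x : M) : T2Space (TangentSpace 𝓘(ℝ, E) x) :=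
  inferInstanceAs (T2Space E)

/-- Smooth vector fields, `𝔛(M)`. -/
abbrev VField (E M : Type*) [NormedAddCommGroup E] [NormedSpace ℝ E]
    [TopologicalSpace M] [ChartedSpace E M] [IsManifold 𝓘(ℝ, E) ∞ M] : Type _ :=
  Cₛ^∞⟮𝓘(ℝ, E); E, fun x : M => TangentSpace 𝓘(ℝ, E) x⟯

/-- Smooth one-forms, `Ω¹(M)`. -/
abbrev OneForm (E M : Type*) [NormedAddCommGroup E] [NormedSpace ℝ E]
    [TopologicalSpace M] [ChartedSpace E M] [IsManifold 𝓘(ℝ, E) ∞ M] : Type _ :=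
  Cₛ^∞⟮𝓘(ℝ, E); E →L[ℝ] ℝ, fun x : M => TangentSpace 𝓘(ℝ, E) x →L[ℝ] ℝ⟯

/-- Smooth sections `X + ξ` of `TM ⊕ T*M`, as pairs `(X, ξ)`. -/
abbrev Sec (E M : Type*) [NormedAddCommGroup E] [NormedSpace ℝ E]
    [TopologicalSpace M] [ChartedSpace E M] [IsManifold 𝓘(ℝ, E) ∞ M] : Type _ :=
  VField E M × OneForm E M

/-- The fibre of `TM ⊕ T*M` at `x`. -/
abbrev Fib (E : Type*) [NormedAddCommGroup E] [NormedSpace ℝ E]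
    {M : Type*} [TopologicalSpace M] [ChartedSpace E M] (x : M) : Type _ :=
  TangentSpace 𝓘(ℝ, E) x × (TangentSpace 𝓘(ℝ, E) x →L[ℝ] ℝ)

/-- The value of a section of `TM ⊕ T*M` at a point. -/
def val (e : Sec E M) (x : M) : Fib E x := (e.1 x, e.2 x)

/-- The section `f • e` for a smooth function `f`. -/
def fmul (f : C^∞⟮𝓘(ℝ, E), M; ℝ⟯) (e : Sec E M) : Sec E M :=
  (⟨fun x => f x • e.1 x, f.contMDiff.smul_section e.1.contMDiff⟩,
    ⟨fun x => f x • e.2 x, f.contMDiff.smul_section e.2.contMDiff⟩)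

/-- The canonical pairing `⟨X + ξ, Y + η⟩ = η(X) + ξ(Y)` on the fibre at `x`. -/
def pairing (x : M) : LinearMap.BilinForm ℝ (Fib E x) :=
  LinearMap.mk₂ ℝ (fun p q => q.2 p.1 + p.2 q.1)
    (by intros; simp; ring) (by intros; simp; ring)
    (by intros; simp; ring) (by intros; simp; ring)

theorem pairing_apply (x : M) (p q : Fib E x) : pairing x p q = q.2 p.1 + p.2 q.1 := rfl

theorem pairing_nondegenerate (x : M) :
    (pairing x : LinearMap.BilinForm ℝ (Fib E x)).Nondegenerate := by
  have h : ∀ p : Fib E x, (∀ q : Fib E x, q.2 p.1 + p.2 q.1 = 0) → p = 0 := by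
    rintro ⟨v, α⟩ hp
    have hα : α = 0 := by
      ext w
      simpa using hp (w, 0)
    have hv : v = 0 := by
      by_contra hne
      obtain ⟨f, hf⟩ := Module.Projective.exists_dual_ne_zero ℝ hne
      have := hp (0, LinearMap.toContinuousLinearMap f)
      simp only [zero_apply, hα, add_zero] at this
      exact hf this
    rw [hα, hv]; rfl
  refine ⟨fun p hp => h p fun q => hp q, fun p hp => h p fun q => ?_⟩
  have := hp q
  rw [pairing_apply] at this
  linarith

/-- `ρ(e).f` at `x`, where the anchor `ρ` is the projection `TM ⊕ T*M → TM`. -/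
def anchorDeriv (e : Sec E M) (f : M → ℝ) (x : M) : ℝ := mvfderiv 𝓘(ℝ, E) f x (e.1 x)

theorem contr_mdiff (η : OneForm E M) {Z : Π x : M, TangentSpace 𝓘(ℝ, E) x} {x : M}
    (hZ : MDiffAt (T% Z) x) : MDiffAt (fun y => η y (Z y)) x := by
  have h := (η.mdifferentiableAt (x := x)).clm_bundle_apply hZ
  simpa [mdifferentiableAt_section] using h

/-- Every vector at `x` is the value of a smooth global section. -/
theorem exists_section [T2Space M] {F : Type*} [NormedAddCommGroup F] [NormedSpace ℝ F]
    {V : M → Type*} [TopologicalSpace (TotalSpace F V)] [∀ x, AddCommGroup (V x)]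
    [∀ x, Module ℝ (V x)] [∀ x, TopologicalSpace (V x)] [FiberBundle F V] [VectorBundle ℝ F V]
    [ContMDiffVectorBundle ∞ F V 𝓘(ℝ, E)] (x : M) (v : V x) :
    ∃ s : Cₛ^∞⟮𝓘(ℝ, E); F, V⟯, s x = v := by
  obtain ⟨u, hu, hs⟩ := FiberBundle.exists_contMDiffOn_extend (k := ∞) 𝓘(ℝ, E) F v
  obtain ⟨u', hu'u, hu'o, hxu'⟩ := mem_nhds_iff.1 hu
  obtain ⟨f, hf⟩ := ((SmoothBumpFunction.nhds_basis_support (I := 𝓘(ℝ, E))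
    (hu'o.mem_nhds hxu')).ex_mem)
  refine ⟨⟨_, ContMDiffOn.smul_section_of_tsupport f.contMDiff.contMDiffOn hu'o hf
    (hs.mono hu'u)⟩, ?_⟩
  change f x • FiberBundle.extend F v x = v
  simp

/-! ### Lie derivative and exterior derivative of one-forms -/

/-- The Lie derivative of a one-form, `(L_X η)(Z) = X.(η(Z)) - η([X, Z])`. -/
def lieForm (X : VField E M) (η : OneForm E M) (x : M) : Cot E x :=
  TensorialAt.mkHom (I := 𝓘(ℝ, E)) (F := E) (fun Z => mvfderiv 𝓘(ℝ, E) (fun y => η y (Z y)) x (X x)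
    - η x (VectorField.mlieBracket 𝓘(ℝ, E) X Z x)) x
    { smul := fun {f σ} hf hσ => by
        have h1 := contr_mdiff η hσ
        simp [VectorField.mlieBracket_smul_right hf hσ, mvfderiv_fun_mul hf h1]
        ring
      add := fun {σ σ'} hσ hσ' => by
        simp [VectorField.mlieBracket_add_right hσ hσ', mvfderiv_fun_add (contr_mdiff η hσ) (contr_mdiff η hσ')]
        ring }

theorem dForm_tensorial₁ (ξ : OneForm E M) (x : M) (Z : Π x : M, TangentSpace 𝓘(ℝ, E) x)
    (_hZ : MDiffAt (T% Z) x) : TensorialAt 𝓘(ℝ, E) E (fun Y : Π x : M, TangentSpace 𝓘(ℝ, E) x =>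
       mvfderiv 𝓘(ℝ, E) (fun y => ξ y (Z y)) x (Y x)
      - mvfderiv 𝓘(ℝ, E) (fun y => ξ y (Y y)) x (Z x)
      - ξ x (VectorField.mlieBracket 𝓘(ℝ, E) Y Z x)) x where
  smul {f σ} hf hσ := by
    simp [VectorField.mlieBracket_smul_left hf hσ, mvfderiv_fun_mul hf (contr_mdiff ξ hσ)]
    ring
  add {σ σ'} hσ hσ' := by
    simp [VectorField.mlieBracket_add_left hσ hσ', mvfderiv_fun_add (contr_mdiff ξ hσ) (contr_mdiff ξ hσ')]
    ring

theorem dForm_tensorial₂ (ξ : OneForm E M) (x : M) (Y : Π x : M, TangentSpace 𝓘(ℝ, E) x)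
    (_hY : MDiffAt (T% Y) x) : TensorialAt 𝓘(ℝ, E) E (fun Z : Π x : M, TangentSpace 𝓘(ℝ, E) x =>
       mvfderiv 𝓘(ℝ, E) (fun y => ξ y (Z y)) x (Y x)
      - mvfderiv 𝓘(ℝ, E) (fun y => ξ y (Y y)) x (Z x)
      - ξ x (VectorField.mlieBracket 𝓘(ℝ, E) Y Z x)) x where
  smul {f σ} hf hσ := by
    simp [VectorField.mlieBracket_smul_right hf hσ, mvfderiv_fun_mul hf (contr_mdiff ξ hσ)]
    ring
  add {σ σ'} hσ hσ' := by
    simp [VectorField.mlieBracket_add_right hσ hσ', mvfderiv_fun_add (contr_mdiff ξ hσ) (contr_mdiff ξ hσ')]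
    ring

/-- The exterior derivative of a one-form,
`dξ(Y, Z) = Y.(ξ(Z)) - Z.(ξ(Y)) - ξ([Y, Z])`; `dForm ξ x Y` is the covector `i_Y dξ`. -/
def dForm (ξ : OneForm E M) (x : M) : Tan E x →L[ℝ] Cot E x :=
  TensorialAt.mkHom₂ (I := 𝓘(ℝ, E)) (F := E) (F' := E) (fun Y Z =>
       mvfderiv 𝓘(ℝ, E) (fun y => ξ y (Z y)) x (Y x)
      - mvfderiv 𝓘(ℝ, E) (fun y => ξ y (Y y)) x (Z x)
      - ξ x (VectorField.mlieBracket 𝓘(ℝ, E) Y Z x)) x (dForm_tensorial₁ ξ x) (dForm_tensorial₂ ξ x)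

/-! ### Riemannian metrics and the Levi-Civita connection -/

/-- Smooth Riemannian metrics on `M`. -/
abbrev RMetric (E M : Type*) [NormedAddCommGroup E] [NormedSpace ℝ E]
    [TopologicalSpace M] [ChartedSpace E M] [IsManifold 𝓘(ℝ, E) ∞ M] : Type _ :=
  ContMDiffRiemannianMetric 𝓘(ℝ, E) ∞ E (fun x : M => TangentSpace 𝓘(ℝ, E) x)

theorem metric_mdiff (g : RMetric E M)
    {Y Z : Π x : M, TangentSpace 𝓘(ℝ, E) x} {x : M}
    (hY : MDiffAt (T% Y) x) (hZ : MDiffAt (T% Z) x) :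
    MDiffAt (fun y => g.inner y (Y y) (Z y)) x := by
  have h := ((g.contMDiff.mdifferentiable (by simp)) x).clm_bundle_apply₂ hY hZ
  simpa [mdifferentiableAt_section] using h

/-- The isomorphism `g : T_x M → T*_x M`, `v ↦ g(v, ·)`; its inverse is `g⁻¹`. -/
def flat (g : RMetric E M) (x : M) : Tan E x ≃ₗ[ℝ] Cot E x :=
  LinearEquiv.ofInjectiveOfFinrankEq (g.inner x : Tan E x →ₗ[ℝ] Cot E x)
   (by
    rw [← LinearMap.ker_eq_bot, LinearMap.ker_eq_bot']
    intro v hv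
    by_contra h
    have := g.pos x v h
    have h2 : g.inner x v = 0 := hv
    simp [h2] at this) (by
     have := (LinearMap.toContinuousLinearMap : (Tan E x →ₗ[ℝ] ℝ) ≃ₗ[ℝ] _).finrank_eq
     rw [← this]
     exact (Subspace.dual_finrank_eq).symm)

/-- The right-hand side of the Koszul formula for `2 g(∇_X Y, Z)`. -/
def koszul (g : RMetric E M) (X Y Z : Π x : M, TangentSpace 𝓘(ℝ, E) x) (x : M) : ℝ :=
  mvfderiv 𝓘(ℝ, E) (fun y => g.inner y (Y y) (Z y)) x (X x)
    + mvfderiv 𝓘(ℝ, E) (fun y => g.inner y (Z y) (X y)) x (Y x)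
    - mvfderiv 𝓘(ℝ, E) (fun y => g.inner y (X y) (Y y)) x (Z x)
    + g.inner x (VectorField.mlieBracket 𝓘(ℝ, E) X Y x) (Z x)
    - g.inner x (VectorField.mlieBracket 𝓘(ℝ, E) X Z x) (Y x)
    - g.inner x (VectorField.mlieBracket 𝓘(ℝ, E) Y Z x) (X x)

theorem koszul_tensorial₁ (g : RMetric E M) {x : M} {Y Z : Π x : M, TangentSpace 𝓘(ℝ, E) x}
    (hY : MDiffAt (T% Y) x) (hZ : MDiffAt (T% Z) x) :
    TensorialAt 𝓘(ℝ, E) E (fun X : Π x : M, TangentSpace 𝓘(ℝ, E) x => koszul g X Y Z x) x where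
  smul {f σ} hf hσ := by
    simp [koszul, VectorField.mlieBracket_smul_left hf hσ,
      mvfderiv_fun_mul hf (metric_mdiff g hσ hY), mvfderiv_fun_mul hf (metric_mdiff g hZ hσ)]
    rw [g.symm x (Z x) (σ x)]
    ring
  add {σ σ'} hσ hσ' := by
    simp [koszul, VectorField.mlieBracket_add_left hσ hσ',
      mvfderiv_fun_add (metric_mdiff g hσ hY) (metric_mdiff g hσ' hY),
      mvfderiv_fun_add (metric_mdiff g hZ hσ) (metric_mdiff g hZ hσ')]
    ring

theorem koszul_tensorial₂ (g : RMetric E M) {x : M} {X Y : Π x : M, TangentSpace 𝓘(ℝ, E) x}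
    (hX : MDiffAt (T% X) x) (hY : MDiffAt (T% Y) x) :
    TensorialAt 𝓘(ℝ, E) E (fun Z : Π x : M, TangentSpace 𝓘(ℝ, E) x => koszul g X Y Z x) x where
  smul {f σ} hf hσ := by
    simp [koszul, VectorField.mlieBracket_smul_right hf hσ,
      mvfderiv_fun_mul hf (metric_mdiff g hσ hX), mvfderiv_fun_mul hf (metric_mdiff g hY hσ)]
    rw [g.symm x (Y x) (σ x)]
    ring
  add {σ σ'} hσ hσ' := by
    simp [koszul, VectorField.mlieBracket_add_right hσ hσ',
      mvfderiv_fun_add (metric_mdiff g hσ hX) (metric_mdiff g hσ' hX),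
      mvfderiv_fun_add (metric_mdiff g hY hσ) (metric_mdiff g hY hσ')]
    ring


open Classical in
/-- The endomorphism `X ↦ ∇^LC_X Y` of `T_x M` given by the Koszul formula. -/
def leviCivitaAt (g : RMetric E M) (Y : Π x : M, TangentSpace 𝓘(ℝ, E) x) (x : M) :
    Tan E x →L[ℝ] Tan E x :=
  if h : MDiffAt (T% Y) x then
    LinearMap.toContinuousLinearMap ((flat g x).symm.toLinearMap ∘ₗ
      ((1 / 2 : ℝ) • (TensorialAt.mkHom₂ (I := 𝓘(ℝ, E)) (F := E) (F' := E)
        (fun X Z => koszul g X Y Z x) x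
        (fun _ hZ => koszul_tensorial₁ g h hZ)
        (fun _ hX => koszul_tensorial₂ g hX h) : Tan E x →L[ℝ] Cot E x).toLinearMap))
  else 0

theorem inner_leviCivitaAt (g : RMetric E M) {X Y Z : Π x : M, TangentSpace 𝓘(ℝ, E) x} {x : M}
    (hX : MDiffAt (T% X) x) (hY : MDiffAt (T% Y) x) (hZ : MDiffAt (T% Z) x) :
    g.inner x (leviCivitaAt g Y x (X x)) (Z x) = 1 / 2 * koszul g X Y Z x := by
  have key : ∀ α : Cot E x, g.inner x ((flat g x).symm α) = α :=
    fun α => (flat g x).apply_symm_apply α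
  rw [leviCivitaAt, dif_pos hY]
  simp only [LinearMap.coe_toContinuousLinearMap', LinearMap.comp_apply, LinearEquiv.coe_coe]
  rw [key]
  simp only [LinearMap.smul_apply, ContinuousLinearMap.coe_coe, smul_apply]
  rw [TensorialAt.mkHom₂_apply _ _ hX hZ]
  simp

theorem clm_ext (g : RMetric E M) {x : M} {A B : Tan E x →L[ℝ] Tan E x}
    (h : ∀ X Z : Π x : M, TangentSpace 𝓘(ℝ, E) x, MDiffAt (T% X) x → MDiffAt (T% Z) x →
      g.inner x (A (X x)) (Z x) = g.inner x (B (X x)) (Z x)) : A = B := by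
  ext v
  apply (flat g x).injective
  ext w
  have := h (FiberBundle.extend E v) (FiberBundle.extend E w) (FiberBundle.mdifferentiableAt_extend ..)
    (FiberBundle.mdifferentiableAt_extend ..)
  simp only [FiberBundle.extend_apply_self] at this
  exact this

/-- The Levi-Civita connection of `g`; `leviCivita g Y x (X x)` is `(∇^LC_X Y)(x)`. The two theorems
below say that it is torsion-free and metric. -/
def leviCivita (g : RMetric E M) :
    CovariantDerivative 𝓘(ℝ, E) E (fun x : M => TangentSpace 𝓘(ℝ, E) x) where
  toFun Y x := leviCivitaAt g Y x
  isCovariantDerivativeOnUniv :=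
    { add := fun {σ σ' x} hσ hσ' _ => by
        refine clm_ext g fun X Z hX hZ => ?_
        have h := inner_leviCivitaAt g hX (mdifferentiableAt_add_section hσ hσ') hZ
        refine h.trans ?_
        rw [add_apply, map_add, add_apply,
          inner_leviCivitaAt g hX hσ hZ, inner_leviCivitaAt g hX hσ' hZ]
        simp [koszul, VectorField.mlieBracket_add_left hσ hσ',
          VectorField.mlieBracket_add_right hσ hσ',
          mvfderiv_fun_add (metric_mdiff g hX hσ) (metric_mdiff g hX hσ'),
          mvfderiv_fun_add (metric_mdiff g hσ hZ) (metric_mdiff g hσ' hZ)]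
        ring
      leibniz := fun {σ f x} hσ hf _ => by
        refine clm_ext g fun X Z hX hZ => ?_
        have h := inner_leviCivitaAt g hX (hf.smul_section hσ) hZ
        refine h.trans ?_
        rw [add_apply, map_add, add_apply,
          smul_apply, map_smul, smul_apply,
          inner_leviCivitaAt g hX hσ hZ]
        simp [koszul, VectorField.mlieBracket_smul_left hf hσ,
          VectorField.mlieBracket_smul_right hf hσ,
          mvfderiv_fun_mul hf (metric_mdiff g hX hσ), mvfderiv_fun_mul hf (metric_mdiff g hσ hZ)]
        rw [g.symm x (X x) (σ x)]
        ring }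

theorem leviCivita_torsion (g : RMetric E M) : (leviCivita g).torsion = 0 := by
  rw [CovariantDerivative.torsion_eq_zero_iff]
  intro X Y x hX hY
  apply (flat g x).injective
  ext w
  have hZ : MDiffAt (T% (FiberBundle.extend E w)) x :=
    FiberBundle.mdifferentiableAt_extend ..
  have h1 := inner_leviCivitaAt g hX hY hZ
  have h2 := inner_leviCivitaAt g hY hX hZ
  have e : FiberBundle.extend E w x = w := by simp
  change g.inner x (leviCivitaAt g Y x (X x) - leviCivitaAt g X x (Y x)) w = g.inner x _ w
  generalize FiberBundle.extend E w = Z at hZ h1 h2 e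
  subst e
  rw [map_sub, sub_apply, h1, h2]
  have s : ∀ A B : Π x : M, TangentSpace 𝓘(ℝ, E) x,
    (fun y => g.inner y (A y) (B y)) = fun y => g.inner y (B y) (A y) :=
    fun A B => funext fun y => g.symm y _ _
  simp only [koszul]
  rw [VectorField.mlieBracket_swap_apply (V := Y) (W := X), s X Z, s Z Y, s Y X]
  simp
  ring

theorem leviCivita_metric (g : RMetric E M) {X Y Z : Π x : M, TangentSpace 𝓘(ℝ, E) x} {x : M}
    (hX : MDiffAt (T% X) x) (hY : MDiffAt (T% Y) x) (hZ : MDiffAt (T% Z) x) :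
    mvfderiv 𝓘(ℝ, E) (fun y => g.inner y (Y y) (Z y)) x (X x) =
      g.inner x (leviCivita g Y x (X x)) (Z x) + g.inner x (Y x) (leviCivita g Z x (X x)) := by
  have h1 := inner_leviCivitaAt g hX hY hZ
  have h2 := inner_leviCivitaAt g hX hZ hY
  change _ = g.inner x (leviCivitaAt g Y x (X x)) (Z x) + g.inner x (Y x) (leviCivitaAt g Z x (X x))
  rw [g.symm x (Y x), h1, h2]
  have s : ∀ A B : Π x : M, TangentSpace 𝓘(ℝ, E) x,
    (fun y => g.inner y (A y) (B y)) = fun y => g.inner y (B y) (A y) :=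
    fun A B => funext fun y => g.symm y _ _
  simp only [koszul]
  rw [VectorField.mlieBracket_swap_apply (V := Z) (W := Y), s X Z, s Z Y, s Y X]
  simp
  ring

/-- The Levi-Civita connection on one-forms, dual to the one on vector fields:
`(∇^LC_X ζ)(Z) = X.(ζ(Z)) - ζ(∇^LC_X Z)`. -/
def leviCivitaForm (g : RMetric E M) (X : VField E M) (ζ : OneForm E M) (x : M) : Cot E x :=
  TensorialAt.mkHom (I := 𝓘(ℝ, E)) (F := E)
    (fun Z => mvfderiv 𝓘(ℝ, E) (fun y => ζ y (Z y)) x (X x) - ζ x (leviCivita g Z x (X x))) x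
    { smul := fun {f σ} hf hσ => by
        simp [(leviCivita g).isCovariantDerivativeOnUniv.leibniz hσ hf,
          mvfderiv_fun_mul hf (contr_mdiff ζ hσ)]
        ring
      add := fun {σ σ'} hσ hσ' => by
        simp [(leviCivita g).isCovariantDerivativeOnUniv.add hσ hσ',
          mvfderiv_fun_add (contr_mdiff ζ hσ) (contr_mdiff ζ hσ')]
        ring }

/-! ### Tensors -/

/-- A smooth tensor field in `Ω¹(M) ⊗ Ω²(M)`: a trilinear form `K(X, Y, Z)`, skew-symmetric in
`(Y, Z)`. The covector `toFun x u v` is `K(u, v, ·)`. -/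
structure OneTwoForm (E M : Type*) [NormedAddCommGroup E] [NormedSpace ℝ E]
    [TopologicalSpace M] [ChartedSpace E M] [IsManifold 𝓘(ℝ, E) ∞ M] where
  toFun : ∀ x : M, Tan E x →ₗ[ℝ] Tan E x →ₗ[ℝ] Cot E x
  skew : ∀ (x : M) (u v w : Tan E x), toFun x u v w = - toFun x u w v
  smooth : ∀ X Y Z : VField E M,
    ContMDiff 𝓘(ℝ, E) 𝓘(ℝ) ∞ (fun x => toFun x (X x) (Y x) (Z x))

/-- A smooth three-form: skew-symmetric in the last two and in the first two arguments. -/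
structure ThreeForm (E M : Type*) [NormedAddCommGroup E] [NormedSpace ℝ E]
    [TopologicalSpace M] [ChartedSpace E M] [IsManifold 𝓘(ℝ, E) ∞ M] extends OneTwoForm E M where
  skew' : ∀ (x : M) (u v w : Tan E x), toFun x u v w = - toFun x v u w

/-- A smooth tensor field in `𝔛(M) ⊗ 𝔛²(M)`, where `𝔛²` are the bivector fields: a trilinear form
`J(ξ, η, ζ)` on covectors, skew-symmetric in `(η, ζ)`. -/
structure OneTwoVector (E M : Type*) [NormedAddCommGroup E] [NormedSpace ℝ E]
    [TopologicalSpace M] [ChartedSpace E M] [IsManifold 𝓘(ℝ, E) ∞ M] where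
  toFun : ∀ x : M, Cot E x →ₗ[ℝ] Cot E x →ₗ[ℝ] Cot E x →ₗ[ℝ] ℝ
  skew : ∀ (x : M) (ξ η ζ : Cot E x), toFun x ξ η ζ = - toFun x ξ ζ η
  smooth : ∀ ξ η ζ : OneForm E M,
    ContMDiff 𝓘(ℝ, E) 𝓘(ℝ) ∞ (fun x => toFun x (ξ x) (η x) (ζ x))

/-- The total skew-symmetrization of a trilinear form. -/
def totalSkew {V : Type*} (T : V → V → V → ℝ) (u v w : V) : ℝ :=
  1 / 6 * (T u v w + T v w u + T w u v - T v u w - T u w v - T w v u)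

/-- The vector `v` with `ζ(v) = Ψ(ζ)` for all covectors `ζ`: the identification `T**_x M = T_x M`. -/
def dualVec (x : M) (Ψ : Cot E x →ₗ[ℝ] ℝ) : Tan E x :=
  (Module.evalEquiv ℝ (Tan E x)).symm
    (Ψ ∘ₗ (LinearMap.toContinuousLinearMap : (Tan E x →ₗ[ℝ] ℝ) ≃ₗ[ℝ] Cot E x).toLinearMap)

theorem apply_dualVec (x : M) (Ψ : Cot E x →ₗ[ℝ] ℝ) (ζ : Cot E x) : ζ (dualVec x Ψ) = Ψ ζ := by
  have h := Module.apply_evalEquiv_symm_apply ℝ (Tan E x) (ζ : Tan E x →ₗ[ℝ] ℝ)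
    (Ψ ∘ₗ (LinearMap.toContinuousLinearMap : (Tan E x →ₗ[ℝ] ℝ) ≃ₗ[ℝ] Cot E x).toLinearMap)
  exact h

/-! ### The twisted Dorfman bracket, connections and torsion -/

/-- The `H`-twisted Dorfman bracket
`[X + ξ, Y + η] = [X, Y] + L_X η - i_Y dξ - H(X, Y, ·)`, evaluated at `x`. -/
def dorfman (H : ThreeForm E M) (e e' : Sec E M) (x : M) : Fib E x :=
  (VectorField.mlieBracket 𝓘(ℝ, E) e.1 e'.1 x,
    lieForm e.1 e'.2 x - dForm e.2 x (e'.1 x) - H.toFun x (e.1 x) (e'.1 x))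

/-- Courant algebroid connections on `TM ⊕ T*M` with the canonical anchor and pairing. -/
structure CourantConnection (E M : Type*) [NormedAddCommGroup E] [NormedSpace ℝ E]
    [TopologicalSpace M] [ChartedSpace E M] [IsManifold 𝓘(ℝ, E) ∞ M] where
  toFun : Sec E M →ₗ[ℝ] Sec E M →ₗ[ℝ] Sec E M
  smul_left : ∀ (f : C^∞⟮𝓘(ℝ, E), M; ℝ⟯) (e e' : Sec E M),
    toFun (fmul f e) e' = fmul f (toFun e e')
  leibniz : ∀ (f : C^∞⟮𝓘(ℝ, E), M; ℝ⟯) (e e' : Sec E M) (x : M),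
    val (toFun e (fmul f e')) x = f x • val (toFun e e') x + anchorDeriv e f x • val e' x
  metric : ∀ (e e' e'' : Sec E M) (x : M),
    anchorDeriv e (fun y => pairing y (val e' y) (val e'' y)) x =
      pairing x (val (toFun e e') x) (val e'' x) + pairing x (val e' x) (val (toFun e e'') x)

/-- A frame of `TM ⊕ T*M` around `x`: smooth sections `e_λ` whose values at `x` are a basis of the
fibre (they are then a basis of the fibres near `x`). -/
structure FrameAt (E : Type*) {M : Type*} [NormedAddCommGroup E] [NormedSpace ℝ E]
    [TopologicalSpace M] [ChartedSpace E M] [IsManifold 𝓘(ℝ, E) ∞ M] (x : M) where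
  k : ℕ
  sec : Fin k → Sec E M
  basis : Module.Basis (Fin k) ℝ (Fib E x)
  basis_eq : ∀ i, basis i = val (sec i) x

theorem nonempty_frameAt [T2Space M] (x : M) : Nonempty (FrameAt E x) := by
  let b := Module.finBasis ℝ (Fib E x)
  choose s hs using fun i => exists_section (E := E) (F := E)
    (V := fun x : M => TangentSpace 𝓘(ℝ, E) x) x (b i).1
  choose t ht using fun i => exists_section (E := E) (F := E →L[ℝ] ℝ)
    (V := fun x : M => TangentSpace 𝓘(ℝ, E) x →L[ℝ] ℝ) x (b i).2
  exact ⟨⟨_, fun i => (s i, t i), b, fun i => by simp [val, hs, ht]⟩⟩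

/-- The torsion operator, computed in a frame `(e_λ)` around `x`:
`T(e, e') = ∇_e e' - ∇_{e'} e - [e, e'] + ∑_λ ⟨∇_{e_λ} e, e'⟩ g_E⁻¹(e^λ)`,
where `g_E` is the canonical pairing and `(e^λ)` the dual frame; `g_E⁻¹(e^λ)` is the member of the
`g_E`-dual basis with index `λ`. -/
def torsion (nabla : CourantConnection E M) (H : ThreeForm E M) {x : M} (fr : FrameAt E x)
    (e e' : Sec E M) : Fib E x :=
  val (nabla.toFun e e') x - val (nabla.toFun e' e) x - dorfman H e e' x
    + ∑ i, pairing x (val (nabla.toFun (fr.sec i) e) x) (val e' x) •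
        (pairing x).dualBasis (pairing_nondegenerate x) fr.basis i

/-- Torsion-freeness: `T = 0` at all points, in whatever frame `T` is computed. -/
def IsTorsionFree (nabla : CourantConnection E M) (H : ThreeForm E M) : Prop :=
  ∀ (e e' : Sec E M) (x : M) (fr : FrameAt E x), torsion nabla H fr e e' = 0

/-- The fibre-wise metric `BlockDiag(g, g⁻¹)` on `TM ⊕ T*M`,
`(X + ξ, Y + η) ↦ g(X, Y) + g⁻¹(ξ, η)`. -/
def blockMetric (g : RMetric E M) (x : M) (p q : Fib E x) : ℝ :=
  g.inner x p.1 q.1 + q.2 ((flat g x).symm p.2)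

/-- Compatibility of a Courant algebroid connection with `BlockDiag(g, g⁻¹)`. -/
def IsCompatible (nabla : CourantConnection E M) (g : RMetric E M) : Prop :=
  ∀ (e e' e'' : Sec E M) (x : M),
    anchorDeriv e (fun y => blockMetric g y (val e' y) (val e'' y)) x =
      blockMetric g x (val (nabla.toFun e e') x) (val e'' x)
        + blockMetric g x (val e' x) (val (nabla.toFun e e'') x)

/-- Levi-Civita Courant algebroid connections with respect to `BlockDiag(g, g⁻¹)` and the
`H`-twisted Dorfman bracket. -/
def IsLeviCivita (nabla : CourantConnection E M) (H : ThreeForm E M) (g : RMetric E M) : Prop :=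
  IsTorsionFree nabla H ∧ IsCompatible nabla g

end Defs

end Courant

end

/-!
Let `∇⁰_{X + ξ}(Y + η) = ∇^LC_X Y + ∇^LC_X η`. This connection preserves both the canonical pairing
and `BlockDiag(g, g⁻¹)`, and its torsion, computed with the `H`-twisted bracket, is the three-form `H`
(`baseConn_pairing`, `baseConn_blockMetric`, `baseConn_torsion`). Any other Courant connection is
determined by `χ(e, e', e'') = ⟨∇_e e' - ∇⁰_e e', e''⟩`, which is skew in its last two arguments.
Under this encoding, with `τ(X + ξ) = g⁻¹ξ + gX`,

* compatibility becomes `χ(e, e', τ e'') = χ(e, τ e', e'')`;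
* torsion-freeness becomes
  `χ(e, e', e'') + χ(e', e'', e) + χ(e'', e, e') = -H(ρ e, ρ e', ρ e'')`.

Tensoriality of `χ` costs nothing: the last slot is pointwise by definition, the middle one by
skew-symmetry, and for torsion-free `∇` the first one by the cyclic identity (`connDiff_congr_left`).
So `χ` is a family of trilinear forms on the fibres (`diffForm`), and the rest is linear algebra.

The `τ`-invariance leaves four trilinear forms on `T_x M`: `χ(u, v, w)`, `χ(u, v, gw)`, `χ(gu, v, w)`
and `χ(gu, gv, w)`. The cyclic identity on one or three covectors says that the second and third
coincide and have vanishing cyclic sum; the common value is `K`. On zero or two covectors it says that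
the last form has cyclic sum `H/2` and differs from the first by `H/2`; removing from the last its
totally skew part `H/6` leaves `-J`, with vanishing cyclic sum, and the first form becomes `-H/3 - J`.
These computations are `diffForm_vvf_cyclic` and `diffForm_ffv_cyclic`; conversely `tensorForm_tau`
and `tensorForm_cyclic` verify both conditions for the prescribed `χ`.

Smoothness of `K` and `J` follows from smoothness of `∇` on sections, of the Koszul expression, and of
the vector field `g⁻¹ζ` (`contMDiff_sharp`).
-/

noncomputable section

namespace Courant

section LeviCivitaConnections

set_option linter.unusedSectionVars false

variable {E : Type*} [NormedAddCommGroup E] [NormedSpace ℝ E] [FiniteDimensional ℝ E]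
  {M : Type*} [TopologicalSpace M] [ChartedSpace E M] [IsManifold 𝓘(ℝ, E) ∞ M]

/-! ### Smoothness of brackets, derivatives and the musical isomorphism -/

theorem contMDiff_mvfderiv_apply {f : M → ℝ} (hf : ContMDiff 𝓘(ℝ, E) 𝓘(ℝ) ∞ f) (X : VField E M) :
    ContMDiff 𝓘(ℝ, E) 𝓘(ℝ) ∞ fun x => mvfderiv 𝓘(ℝ, E) f x (X x) := by
  have h := (hf.contMDiff_tangentMap (m := ∞) (by simp)).comp X.contMDiff
  exact (contMDiff_snd_tangentBundle_modelSpace ℝ 𝓘(ℝ)).comp h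

/-- The vector field `[X, Y]`. -/
def bracketField (X Y : VField E M) : VField E M :=
  ⟨fun x => VectorField.mlieBracket 𝓘(ℝ, E) X Y x, fun x =>
    haveI : IsManifold 𝓘(ℝ, E) (minSmoothness ℝ 2) M := IsManifold.of_le (n := ∞) (by
      rw [minSmoothness_of_isRCLikeNormedField]; exact WithTop.coe_le_coe.2 (le_top : (2 : ℕ∞) ≤ ⊤))
    haveI : IsManifold 𝓘(ℝ, E) ((⊤ : ℕ∞) + 1) M := IsManifold.of_le (n := ∞) (by simp)
    ContMDiffAt.mlieBracket_vectorField (m := ⊤) (n := ⊤) (X.contMDiff x) (Y.contMDiff x) (by simp)⟩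

theorem contMDiff_inner (g : RMetric E M) (Y Z : VField E M) :
    ContMDiff 𝓘(ℝ, E) 𝓘(ℝ) ∞ fun x => g.inner x (Y x) (Z x) := by
  have h := g.contMDiff.clm_bundle_apply₂ Y.contMDiff Z.contMDiff
  intro x
  simpa [contMDiffAt_section] using h x

theorem contMDiff_contr (η : OneForm E M) (Z : VField E M) :
    ContMDiff 𝓘(ℝ, E) 𝓘(ℝ) ∞ fun x => η x (Z x) := by
  have h := η.contMDiff.clm_bundle_apply Z.contMDiff
  intro x
  simpa [contMDiffAt_section] using h x

/-- The Koszul formula exhibits this function as smooth. -/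
theorem contMDiff_inner_leviCivita (g : RMetric E M) (X Y Z : VField E M) :
    ContMDiff 𝓘(ℝ, E) 𝓘(ℝ) ∞ fun x => g.inner x (leviCivita g Y x (X x)) (Z x) := by
  have h : (fun x => g.inner x (leviCivita g Y x (X x)) (Z x)) =
      fun x => 1 / 2 * koszul g X Y Z x := funext fun x =>
    inner_leviCivitaAt g X.mdifferentiableAt Y.mdifferentiableAt Z.mdifferentiableAt
  rw [h]
  have d : ∀ A B C : VField E M, ContMDiff 𝓘(ℝ, E) 𝓘(ℝ) ∞ fun x =>
      mvfderiv 𝓘(ℝ, E) (fun y => g.inner y (A y) (B y)) x (C x) :=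
    fun A B C => contMDiff_mvfderiv_apply (contMDiff_inner g A B) C
  have b : ∀ A B C : VField E M, ContMDiff 𝓘(ℝ, E) 𝓘(ℝ) ∞ fun x =>
      g.inner x (VectorField.mlieBracket 𝓘(ℝ, E) A B x) (C x) :=
    fun A B C => contMDiff_inner g (bracketField A B) C
  exact contMDiff_const.mul ((((((d Y Z X).add (d Z X Y)).sub (d X Y Z)).add (b X Y Z)).sub
    (b X Z Y)).sub (b Y Z X))

theorem flat_apply (g : RMetric E M) (x : M) (v w : Tan E x) : flat g x v w = g.inner x v w := rfl

/-- The isomorphism `flat g x` as a continuous linear equivalence; finite-dimensionality makes the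
inverse continuous. -/
def flatCLE (g : RMetric E M) (x : M) : Tan E x ≃L[ℝ] Cot E x where
  toLinearEquiv := flat g x
  continuous_toFun := (g.inner x).continuous
  continuous_invFun := LinearMap.continuous_of_finiteDimensional (flat g x).symm.toLinearMap

/-- Near `x₀` the metric read in trivializations is an invertible operator depending smoothly on the
point, and inversion of operators is smooth. -/
theorem contMDiff_sharp (g : RMetric E M) (ζ : OneForm E M) :
    ContMDiff 𝓘(ℝ, E) (𝓘(ℝ, E).prod 𝓘(ℝ, E)) ∞
      fun x => TotalSpace.mk' E (E := fun x : M => TangentSpace 𝓘(ℝ, E) x) x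
        ((flat g x).symm (ζ x)) := by
  intro x₀
  have hg := ((contMDiffAt_hom_bundle _).1 (g.contMDiff x₀)).2
  have hx : x₀ ∈ (trivializationAt E (fun x : M => TangentSpace 𝓘(ℝ, E) x) x₀).baseSet :=
    FiberBundle.mem_baseSet_trivializationAt' x₀
  have hx' : x₀ ∈ (trivializationAt (E →L[ℝ] ℝ)
      (fun x : M => TangentSpace 𝓘(ℝ, E) x →L[ℝ] ℝ) x₀).baseSet :=
    FiberBundle.mem_baseSet_trivializationAt' x₀
  refine ContMDiffAt.clm_apply_of_inCoordinates (F₁ := E →L[ℝ] ℝ) (F₂ := E)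
    (E₁ := fun x : M => TangentSpace 𝓘(ℝ, E) x →L[ℝ] ℝ)
    (E₂ := fun x : M => TangentSpace 𝓘(ℝ, E) x) (b₁ := fun x => x) (b₂ := fun x => x)
    (v := fun x => ζ x) (ϕ := fun x => ((flatCLE g x).symm : Cot E x →L[ℝ] Tan E x))
    ?_ (ζ.contMDiff x₀) contMDiffAt_id
  have key : ∀ x : M, x ∈ (trivializationAt E (fun x : M => TangentSpace 𝓘(ℝ, E) x) x₀).baseSet →
      x ∈ (trivializationAt (E →L[ℝ] ℝ)
        (fun x : M => TangentSpace 𝓘(ℝ, E) x →L[ℝ] ℝ) x₀).baseSet →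
      ∃ e : E ≃L[ℝ] (E →L[ℝ] ℝ),
        ContinuousLinearMap.inCoordinates E (fun x : M => TangentSpace 𝓘(ℝ, E) x)
          (E →L[ℝ] ℝ) (fun x : M => TangentSpace 𝓘(ℝ, E) x →L[ℝ] ℝ) x₀ x x₀ x (g.inner x) = e ∧
        ContinuousLinearMap.inCoordinates
          (E →L[ℝ] ℝ) (fun x : M => TangentSpace 𝓘(ℝ, E) x →L[ℝ] ℝ)
          E (fun x : M => TangentSpace 𝓘(ℝ, E) x) x₀ x x₀ x (flatCLE g x).symm =
            (e.symm : (E →L[ℝ] ℝ) →L[ℝ] E) := by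
    intro x h h'
    refine ⟨(((trivializationAt E (fun x : M => TangentSpace 𝓘(ℝ, E) x)
      x₀).continuousLinearEquivAt ℝ x h).symm.trans (flatCLE g x)).trans
      ((trivializationAt (E →L[ℝ] ℝ) (fun x : M => TangentSpace 𝓘(ℝ, E) x →L[ℝ] ℝ)
      x₀).continuousLinearEquivAt ℝ x h'), ?_, ?_⟩
    · rw [ContinuousLinearMap.inCoordinates_eq h h']
      rfl
    · rw [ContinuousLinearMap.inCoordinates_eq h' h]
      rfl
  -- In the trivializations at `x₀`, the coordinate expression of `g⁻¹` is the inverse of that of `g`.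
  obtain ⟨e, he, -⟩ := key x₀ hx hx'
  have hinv : ContDiffAt ℝ ∞ ContinuousLinearMap.inverse
      (e : E →L[ℝ] (E →L[ℝ] ℝ)) := contDiffAt_map_inverse e
  rw [← he] at hinv
  refine (hinv.contMDiffAt.comp x₀ hg).congr_of_eventuallyEq ?_
  filter_upwards [(trivializationAt E _ x₀).open_baseSet.mem_nhds hx,
    (trivializationAt (E →L[ℝ] ℝ) _ x₀).open_baseSet.mem_nhds hx'] with x h h'
  obtain ⟨e', he', he''⟩ := key x h h'
  rw [he'', Function.comp_apply]
  erw [he']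
  exact (ContinuousLinearMap.inverse_equiv e').symm

/-- The vector field `g⁻¹(ζ)`. -/
def sharp (g : RMetric E M) (ζ : OneForm E M) : VField E M :=
  ⟨fun x => (flat g x).symm (ζ x), contMDiff_sharp g ζ⟩

/-! ### Pointwise linear algebra of the pairing -/

theorem flat_symm_apply_comm (g : RMetric E M) (x : M) (α β : Cot E x) :
    α ((flat g x).symm β) = β ((flat g x).symm α) := by
  obtain ⟨v, rfl⟩ := (flat g x).surjective α
  obtain ⟨w, rfl⟩ := (flat g x).surjective β
  simp only [LinearEquiv.symm_apply_apply, flat_apply]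
  exact g.symm x v w

theorem pairing_comm (x : M) (p q : Fib E x) : pairing x p q = pairing x q p := by
  rw [pairing_apply, pairing_apply, add_comm]

theorem eq_of_pairing_eq {x : M} {p q : Fib E x} (h : ∀ r, pairing x p r = pairing x q r) :
    p = q := by
  refine sub_eq_zero.1 ((pairing_nondegenerate x).1 _ fun r => ?_)
  rw [map_sub, LinearMap.sub_apply, h r, sub_self]

/-! ### The base connection -/

theorem lieForm_apply (X : VField E M) (η : OneForm E M) (Z : VField E M) (x : M) :
    lieForm X η x (Z x) = mvfderiv 𝓘(ℝ, E) (fun y => η y (Z y)) x (X x)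
      - η x (VectorField.mlieBracket 𝓘(ℝ, E) X Z x) :=
  TensorialAt.mkHom_apply _ Z.mdifferentiableAt

theorem dForm_apply (ξ : OneForm E M) (Y Z : VField E M) (x : M) :
    dForm ξ x (Y x) (Z x) = mvfderiv 𝓘(ℝ, E) (fun y => ξ y (Z y)) x (Y x)
      - mvfderiv 𝓘(ℝ, E) (fun y => ξ y (Y y)) x (Z x)
      - ξ x (VectorField.mlieBracket 𝓘(ℝ, E) Y Z x) :=
  TensorialAt.mkHom₂_apply _ _ Y.mdifferentiableAt Z.mdifferentiableAt

theorem leviCivitaForm_apply (g : RMetric E M) (X : VField E M) (ζ : OneForm E M) (Z : VField E M)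
    (x : M) : leviCivitaForm g X ζ x (Z x) =
      mvfderiv 𝓘(ℝ, E) (fun y => ζ y (Z y)) x (X x) - ζ x (leviCivita g Z x (X x)) :=
  TensorialAt.mkHom_apply _ Z.mdifferentiableAt

/-- The connection on one-forms is conjugate to the one on vector fields under `g`, because `∇^LC` is
metric. In particular it depends on `X` only through `X x`. -/
theorem leviCivitaForm_eq_flat [T2Space M] (g : RMetric E M) (X : VField E M) (ζ : OneForm E M)
    (x : M) : leviCivitaForm g X ζ x = flat g x (leviCivita g (sharp g ζ) x (X x)) := by
  ext w
  obtain ⟨W, rfl⟩ := exists_section (E := E) (F := E) (V := fun x : M => TangentSpace 𝓘(ℝ, E) x) x w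
  have h : ∀ y : M, ∀ v : Tan E y, ζ y v = g.inner y (sharp g ζ y) v := fun y v =>
    (DFunLike.congr_fun ((flat g y).apply_symm_apply (ζ y)) v).symm
  have e : (fun y => ζ y (W y)) = fun y => g.inner y (sharp g ζ y) (W y) :=
    funext fun y => h y _
  rw [leviCivitaForm_apply, flat_apply, e, leviCivita_metric g X.mdifferentiableAt
    (sharp g ζ).mdifferentiableAt W.mdifferentiableAt, h, add_sub_cancel_right]

theorem leviCivita_add (g : RMetric E M) (Y Y' : VField E M) (x : M) :
    leviCivita g (Y + Y' : VField E M) x = leviCivita g Y x + leviCivita g Y' x :=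
  (leviCivita g).isCovariantDerivativeOnUniv.add Y.mdifferentiableAt Y'.mdifferentiableAt

theorem leviCivita_smul (g : RMetric E M) (c : ℝ) (Y : VField E M) (x : M) :
    leviCivita g (c • Y : VField E M) x = c • leviCivita g Y x :=
  (leviCivita g).isCovariantDerivativeOnUniv.smul_const c Y.mdifferentiableAt

theorem sharp_add (g : RMetric E M) (ζ ζ' : OneForm E M) :
    sharp g (ζ + ζ') = sharp g ζ + sharp g ζ' :=
  ContMDiffSection.ext fun x => map_add (flat g x).symm (ζ x) (ζ' x)

theorem sharp_smul (g : RMetric E M) (c : ℝ) (ζ : OneForm E M) :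
    sharp g (c • ζ) = c • sharp g ζ :=
  ContMDiffSection.ext fun x => map_smul (flat g x).symm c (ζ x)

/-- The connection `∇⁰_{X + ξ}(Y + η) = ∇^LC_X Y + ∇^LC_X η`, evaluated at a point. -/
def baseConn (g : RMetric E M) (e e' : Sec E M) (x : M) : Fib E x :=
  (leviCivita g e'.1 x (e.1 x), leviCivitaForm g e.1 e'.2 x)

/-- `∇_e e' - ∇⁰_e e'` at a point. -/
def connDiff (nabla : CourantConnection E M) (g : RMetric E M) (e e' : Sec E M) (x : M) : Fib E x :=
  val (nabla.toFun e e') x - baseConn g e e' x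

theorem baseConn_pairing (g : RMetric E M) (e e' e'' : Sec E M) (x : M) :
    anchorDeriv e (fun y => pairing y (val e' y) (val e'' y)) x =
      pairing x (baseConn g e e' x) (val e'' x) + pairing x (val e' x) (baseConn g e e'' x) := by
  simp only [pairing_apply, val, baseConn, anchorDeriv]
  rw [mvfderiv_fun_add ((contMDiff_contr _ _).mdifferentiable (by simp) x)
    ((contMDiff_contr _ _).mdifferentiable (by simp) x), add_apply,
    leviCivitaForm_apply, leviCivitaForm_apply]
  ring

theorem baseConn_blockMetric [T2Space M] (g : RMetric E M) (e e' e'' : Sec E M) (x : M) :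
    anchorDeriv e (fun y => blockMetric g y (val e' y) (val e'' y)) x =
      blockMetric g x (baseConn g e e' x) (val e'' x)
        + blockMetric g x (val e' x) (baseConn g e e'' x) := by
  have h : ∀ y, e''.2 y ((flat g y).symm (e'.2 y)) =
      g.inner y (sharp g e'.2 y) (sharp g e''.2 y) := fun y => by
    rw [g.symm]
    exact (DFunLike.congr_fun ((flat g y).apply_symm_apply (e''.2 y)) _).symm
  have h' : ∀ y (w : Tan E y), e''.2 y w = g.inner y (sharp g e''.2 y) w := fun y w =>
    (DFunLike.congr_fun ((flat g y).apply_symm_apply (e''.2 y)) w).symm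
  simp only [blockMetric, val, baseConn, anchorDeriv, h, leviCivitaForm_eq_flat,
    LinearEquiv.symm_apply_apply, flat_apply]
  rw [mvfderiv_fun_add ((contMDiff_inner g _ _).mdifferentiable (by simp) x)
    ((contMDiff_inner g _ _).mdifferentiable (by simp) x), add_apply,
    leviCivita_metric g e.1.mdifferentiableAt e'.1.mdifferentiableAt e''.1.mdifferentiableAt,
    leviCivita_metric g e.1.mdifferentiableAt (sharp g e'.2).mdifferentiableAt
      (sharp g e''.2).mdifferentiableAt, h', g.symm x (sharp g e''.2 x),
    g.symm x _ ((flat g x).symm (e'.2 x))]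
  exact add_add_add_comm _ _ _ _

/-- The torsion of `∇⁰`, computed with the twisted bracket, is the three-form `H`. -/
theorem baseConn_torsion (g : RMetric E M) (H : ThreeForm E M) (e e' e'' : Sec E M) (x : M) :
    pairing x (baseConn g e e' x - baseConn g e' e x - dorfman H e e' x) (val e'' x)
      + pairing x (baseConn g e'' e x) (val e' x) = H.toFun x (e.1 x) (e'.1 x) (e''.1 x) := by
  have t : ∀ X Y : VField E M, VectorField.mlieBracket 𝓘(ℝ, E) X Y x =
      leviCivita g Y x (X x) - leviCivita g X x (Y x) := fun X Y =>
    ((CovariantDerivative.torsion_eq_zero_iff (leviCivita g)).1 (leviCivita_torsion g)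
      X.mdifferentiableAt Y.mdifferentiableAt).symm
  simp only [map_sub, LinearMap.sub_apply, pairing_apply, val, baseConn, dorfman, sub_apply,
    leviCivitaForm_apply, lieForm_apply, dForm_apply, t]
  ring

theorem connDiff_pairing_skew (nabla : CourantConnection E M) (g : RMetric E M)
    (e e' e'' : Sec E M) (x : M) :
    pairing x (connDiff nabla g e e' x) (val e'' x) =
      - pairing x (connDiff nabla g e e'' x) (val e' x) := by
  have h := nabla.metric e e' e'' x
  rw [baseConn_pairing g] at h
  simp only [connDiff, map_sub, LinearMap.sub_apply]
  rw [pairing_comm x (val (nabla.toFun e e'') x), pairing_comm x (baseConn g e e'' x)]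
  linarith

/-- The involution `X + ξ ↦ g⁻¹ξ + gX` relating the pairing to `BlockDiag(g, g⁻¹)`. -/
def tau (g : RMetric E M) (x : M) (p : Fib E x) : Fib E x := ((flat g x).symm p.2, flat g x p.1)

theorem blockMetric_eq_pairing (g : RMetric E M) (x : M) (p q : Fib E x) :
    blockMetric g x p q = pairing x p (tau g x q) := by
  rw [blockMetric, pairing_apply, tau, flat_apply, g.symm, flat_symm_apply_comm]

theorem blockMetric_comm (g : RMetric E M) (x : M) (p q : Fib E x) :
    blockMetric g x p q = blockMetric g x q p := by
  rw [blockMetric, blockMetric, g.symm, flat_symm_apply_comm]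

/-- Since `∇⁰` is compatible with `BlockDiag(g, g⁻¹)`, compatibility of `∇` says that the difference is
skew for `BlockDiag(g, g⁻¹) = ⟨·, τ ·⟩`. -/
theorem isCompatible_iff [T2Space M] (nabla : CourantConnection E M) (g : RMetric E M) :
    IsCompatible nabla g ↔ ∀ (e e' e'' : Sec E M) (x : M),
      pairing x (connDiff nabla g e e' x) (tau g x (val e'' x)) =
        - pairing x (connDiff nabla g e e'' x) (tau g x (val e' x)) := by
  refine forall₄_congr fun e e' e'' x => ?_
  rw [baseConn_blockMetric g, blockMetric_comm g x (val e' x), blockMetric_comm g x (val e' x)]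
  simp only [blockMetric_eq_pairing, connDiff, map_sub, LinearMap.sub_apply]
  constructor <;> intro h <;> linarith

/-- Pairing with a frame element picks out a single term of the frame sum in the torsion. -/
theorem pairing_torsion (nabla : CourantConnection E M) (g : RMetric E M) (H : ThreeForm E M)
    {x : M} (fr : FrameAt E x) (e e' : Sec E M) (j : Fin fr.k) :
    pairing x (torsion nabla H fr e e') (val (fr.sec j) x) =
      pairing x (connDiff nabla g e e' x) (val (fr.sec j) x)
        - pairing x (connDiff nabla g e' e x) (val (fr.sec j) x)
        + pairing x (connDiff nabla g (fr.sec j) e x) (val e' x)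
        + H.toFun x (e.1 x) (e'.1 x) ((fr.sec j).1 x) := by
  have hs : pairing x (∑ i, pairing x (val (nabla.toFun (fr.sec i) e) x) (val e' x) •
      (pairing x).dualBasis (pairing_nondegenerate x) fr.basis i) (val (fr.sec j) x) =
      pairing x (val (nabla.toFun (fr.sec j) e) x) (val e' x) := by
    rw [← fr.basis_eq j, map_sum, LinearMap.sum_apply]
    simp only [map_smul, LinearMap.smul_apply, LinearMap.BilinForm.apply_dualBasis_left]
    simp
  rw [torsion, map_add, LinearMap.add_apply, hs, ← baseConn_torsion g]
  simp only [connDiff, map_sub, LinearMap.sub_apply]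
  ring

/-- Torsion-freeness is a cyclic identity for the difference from `∇⁰`. The third argument ranges over
frame elements only: the frame sum in the torsion evaluates `∇` along these sections. -/
theorem isTorsionFree_iff (nabla : CourantConnection E M) (g : RMetric E M)
    (H : ThreeForm E M) : IsTorsionFree nabla H ↔
      ∀ (x : M) (fr : FrameAt E x) (e e' : Sec E M) (j : Fin fr.k),
      pairing x (connDiff nabla g e e' x) (val (fr.sec j) x)
        + pairing x (connDiff nabla g e' (fr.sec j) x) (val e x)
        + pairing x (connDiff nabla g (fr.sec j) e x) (val e' x)
        = - H.toFun x (e.1 x) (e'.1 x) ((fr.sec j).1 x) := by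
  constructor
  · intro h x fr e e' j
    have := pairing_torsion nabla g H fr e e' j
    rw [h, map_zero, LinearMap.zero_apply, connDiff_pairing_skew nabla g e'] at this
    linarith
  · intro h e e' x fr
    refine eq_of_pairing_eq fun r => ?_
    rw [map_zero]
    refine DFunLike.congr_fun (fr.basis.ext (f₁ := pairing x (torsion nabla H fr e e')) (f₂ := 0)
      fun j => ?_) r
    have h1 := pairing_torsion nabla g H fr e e' j
    have h2 := h x fr e e' j
    rw [connDiff_pairing_skew nabla g e'] at h2
    rw [fr.basis_eq, h1, LinearMap.zero_apply]
    linarith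

/-! ### The difference tensor -/

theorem exists_sec [T2Space M] {x : M} (p : Fib E x) : ∃ e : Sec E M, val e x = p := by
  obtain ⟨X, hX⟩ := exists_section (E := E) (F := E)
    (V := fun x : M => TangentSpace 𝓘(ℝ, E) x) x p.1
  obtain ⟨ξ, hξ⟩ := exists_section (E := E) (F := E →L[ℝ] ℝ)
    (V := fun x : M => TangentSpace 𝓘(ℝ, E) x →L[ℝ] ℝ) x p.2
  exact ⟨(X, ξ), Prod.ext hX hξ⟩

theorem connDiff_add_left [T2Space M] (nabla : CourantConnection E M) (g : RMetric E M)
    (e₁ e₂ e' : Sec E M) (x : M) : connDiff nabla g (e₁ + e₂) e' x =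
      connDiff nabla g e₁ e' x + connDiff nabla g e₂ e' x := by
  have h : baseConn g (e₁ + e₂) e' x = baseConn g e₁ e' x + baseConn g e₂ e' x := by
    simp only [baseConn, leviCivitaForm_eq_flat, Prod.fst_add, ContMDiffSection.coe_add,
      Pi.add_apply, map_add, Prod.mk_add_mk]
  have h' : val (nabla.toFun (e₁ + e₂) e') x =
      val (nabla.toFun e₁ e') x + val (nabla.toFun e₂ e') x := by
    rw [map_add, LinearMap.add_apply]; rfl
  rw [connDiff, h, h', connDiff, connDiff]
  abel

theorem connDiff_smul_left [T2Space M] (nabla : CourantConnection E M) (g : RMetric E M)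
    (c : ℝ) (e e' : Sec E M) (x : M) : connDiff nabla g (c • e) e' x =
      c • connDiff nabla g e e' x := by
  have h : baseConn g (c • e) e' x = c • baseConn g e e' x := by
    simp only [baseConn, leviCivitaForm_eq_flat, Prod.smul_fst, ContMDiffSection.coe_smul,
      Pi.smul_apply, map_smul, Prod.smul_mk]
  have h' : val (nabla.toFun (c • e) e') x = c • val (nabla.toFun e e') x :=
    congrArg (fun L : Sec E M →ₗ[ℝ] Sec E M => val (L e') x) (nabla.toFun.map_smul c e)
  rw [connDiff, h, h', connDiff, smul_sub]

theorem connDiff_add_right [T2Space M] (nabla : CourantConnection E M) (g : RMetric E M)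
    (e e₁ e₂ : Sec E M) (x : M) : connDiff nabla g e (e₁ + e₂) x =
      connDiff nabla g e e₁ x + connDiff nabla g e e₂ x := by
  have h : baseConn g e (e₁ + e₂) x = baseConn g e e₁ x + baseConn g e e₂ x := by
    simp only [baseConn, leviCivitaForm_eq_flat, Prod.fst_add, Prod.snd_add, sharp_add,
      leviCivita_add, add_apply, map_add, Prod.mk_add_mk]
  have h' : val (nabla.toFun e (e₁ + e₂)) x =
      val (nabla.toFun e e₁) x + val (nabla.toFun e e₂) x := by
    rw [map_add]; rfl
  rw [connDiff, h, h', connDiff, connDiff]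
  abel

theorem connDiff_smul_right [T2Space M] (nabla : CourantConnection E M) (g : RMetric E M)
    (c : ℝ) (e e' : Sec E M) (x : M) : connDiff nabla g e (c • e') x =
      c • connDiff nabla g e e' x := by
  have h : baseConn g e (c • e') x = c • baseConn g e e' x := by
    simp only [baseConn, leviCivitaForm_eq_flat, Prod.smul_fst, Prod.smul_snd, sharp_smul,
      leviCivita_smul, smul_apply, map_smul, Prod.smul_mk]
  have h' : val (nabla.toFun e (c • e')) x = c • val (nabla.toFun e e') x :=
    congrArg (fun s : Sec E M => val s x) ((nabla.toFun e).map_smul c e')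
  rw [connDiff, h, h', connDiff, smul_sub]

/-- The right-hand slot of the difference is tensorial: by skew-symmetry it can be exchanged with the
third argument, on which the dependence is pointwise by definition. -/
theorem connDiff_congr_right [T2Space M] (nabla : CourantConnection E M) (g : RMetric E M)
    (e : Sec E M) {e₁ e₂ : Sec E M} {x : M} (h : val e₁ x = val e₂ x) :
    connDiff nabla g e e₁ x = connDiff nabla g e e₂ x := by
  refine eq_of_pairing_eq fun r => ?_
  obtain ⟨e'', rfl⟩ := exists_sec r
  rw [connDiff_pairing_skew, connDiff_pairing_skew nabla g e e₂, h]

/-- For a torsion-free connection the left-hand slot of the difference is tensorial: the cyclic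
identity expresses it through terms in which this argument stands in a tensorial slot. -/
theorem connDiff_congr_left [T2Space M] {nabla : CourantConnection E M} (g : RMetric E M)
    {H : ThreeForm E M} (hT : IsTorsionFree nabla H) {e₁ e₂ : Sec E M} (e' : Sec E M) {x : M}
    (h : val e₁ x = val e₂ x) :
    connDiff nabla g e₁ e' x = connDiff nabla g e₂ e' x := by
  obtain ⟨fr⟩ := nonempty_frameAt (E := E) x
  refine eq_of_pairing_eq fun r => DFunLike.congr_fun (fr.basis.ext fun j => ?_) r
  have h1 := (isTorsionFree_iff nabla g H).1 hT x fr e₁ e' j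
  have h2 := (isTorsionFree_iff nabla g H).1 hT x fr e₂ e' j
  have h3 : e₁.1 x = e₂.1 x := congrArg Prod.fst h
  rw [connDiff_congr_right nabla g _ h, h, h3] at h1
  rw [fr.basis_eq]
  linarith

/-- The trilinear form `⟨∇_p q - ∇⁰_p q, r⟩` on the fibre at `x`, where the fibre elements `p`, `q`
are extended linearly to sections by means of a frame. -/
def diffForm [T2Space M] (nabla : CourantConnection E M) (g : RMetric E M) (x : M) :
    Fib E x →ₗ[ℝ] Fib E x →ₗ[ℝ] Fib E x →ₗ[ℝ] ℝ :=
  let fr : FrameAt E x := (nonempty_frameAt x).some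
  LinearMap.mk₂ ℝ (fun p q => pairing x (connDiff nabla g (fr.basis.constr ℝ fr.sec p)
      (fr.basis.constr ℝ fr.sec q) x))
    (by intros; simp only [map_add, connDiff_add_left])
    (by intros; simp only [map_smul, connDiff_smul_left])
    (by intros; simp only [map_add, connDiff_add_right])
    (by intros; simp only [map_smul, connDiff_smul_right])

theorem val_constr {x : M} (fr : FrameAt E x) (p : Fib E x) :
    val (fr.basis.constr ℝ fr.sec p) x = p := by
  let ev : Sec E M →ₗ[ℝ] Fib E x :=
    { toFun := fun e => val e x, map_add' := fun _ _ => rfl, map_smul' := fun _ _ => rfl }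
  have h : ev ∘ₗ fr.basis.constr ℝ fr.sec = LinearMap.id := fr.basis.ext fun i => by
    rw [LinearMap.comp_apply, fr.basis.constr_basis, fr.basis_eq]; rfl
  exact DFunLike.congr_fun h p

section
variable [T2Space M] {nabla : CourantConnection E M} {g : RMetric E M} {H : ThreeForm E M}

theorem diffForm_apply (hT : IsTorsionFree nabla H) (e e' : Sec E M) (x : M) :
    diffForm nabla g x (val e x) (val e' x) = pairing x (connDiff nabla g e e' x) := by
  refine congrArg (pairing x) ?_
  rw [connDiff_congr_left g hT _ (val_constr _ _), connDiff_congr_right nabla g _ (val_constr _ _)]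

theorem diffForm_skew (x : M) (p q r : Fib E x) :
    diffForm nabla g x p q r = - diffForm nabla g x p r q := by
  have h := connDiff_pairing_skew nabla g
    ((nonempty_frameAt (E := E) x).some.basis.constr ℝ (nonempty_frameAt x).some.sec p)
    ((nonempty_frameAt (E := E) x).some.basis.constr ℝ (nonempty_frameAt x).some.sec q)
    ((nonempty_frameAt (E := E) x).some.basis.constr ℝ (nonempty_frameAt x).some.sec r) x
  rwa [val_constr, val_constr] at h

/-- Compatibility with `BlockDiag(g, g⁻¹)`: the difference endomorphisms commute with `τ`. -/
theorem diffForm_tau (hC : IsCompatible nabla g) (x : M) (p q r : Fib E x) :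
    diffForm nabla g x p q (tau g x r) = diffForm nabla g x p (tau g x q) r := by
  rw [diffForm_skew x p (tau g x q) r]
  have h := (isCompatible_iff nabla g).1 hC
    ((nonempty_frameAt (E := E) x).some.basis.constr ℝ (nonempty_frameAt x).some.sec p)
    ((nonempty_frameAt (E := E) x).some.basis.constr ℝ (nonempty_frameAt x).some.sec q)
    ((nonempty_frameAt (E := E) x).some.basis.constr ℝ (nonempty_frameAt x).some.sec r) x
  rwa [val_constr, val_constr] at h

theorem diffForm_cyclic (hT : IsTorsionFree nabla H) (x : M) (p q r : Fib E x) :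
    diffForm nabla g x p q r + diffForm nabla g x q r p + diffForm nabla g x r p q =
      - H.toFun x p.1 q.1 r.1 := by
  obtain ⟨fr⟩ := nonempty_frameAt (E := E) x
  obtain ⟨e, rfl⟩ := exists_sec p
  obtain ⟨e', rfl⟩ := exists_sec q
  have h : diffForm nabla g x (val e x) (val e' x) +
      (diffForm nabla g x (val e' x)).flip (val e x) +
      ((diffForm nabla g x).flip (val e x)).flip (val e' x) =
      - ((H.toFun x (e.1 x) (e'.1 x)).toLinearMap ∘ₗ LinearMap.fst ℝ _ _) := by
    refine fr.basis.ext fun j => ?_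
    have h1 := (isTorsionFree_iff nabla g H).1 hT x fr e e' j
    rw [fr.basis_eq]
    simp only [LinearMap.add_apply, LinearMap.flip_apply, diffForm_apply hT]
    exact h1
  exact DFunLike.congr_fun h r
end

/-! ### The form of a Levi-Civita connection -/

/-- The trilinear form `⟨A_p q, r⟩`, where `A` is the difference from `∇⁰` prescribed by `H`, `K`
and `J`. -/
def tensorForm (g : RMetric E M) (H : ThreeForm E M) (K : OneTwoForm E M) (J : OneTwoVector E M)
    (x : M) (p q r : Fib E x) : ℝ :=
  (- (1 / 3) * H.toFun x p.1 q.1 r.1 - J.toFun x (flat g x p.1) (flat g x q.1) (flat g x r.1))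
  + K.toFun x p.1 q.1 ((flat g x).symm r.2)
  + K.toFun x p.1 ((flat g x).symm q.2) r.1
  + (- (1 / 3) * H.toFun x p.1 ((flat g x).symm q.2) ((flat g x).symm r.2)
    - J.toFun x (flat g x p.1) q.2 r.2)
  + K.toFun x ((flat g x).symm p.2) q.1 r.1
  + (1 / 6 * H.toFun x ((flat g x).symm p.2) ((flat g x).symm q.2) r.1
    - J.toFun x p.2 q.2 (flat g x r.1))
  + (1 / 6 * H.toFun x ((flat g x).symm p.2) q.1 ((flat g x).symm r.2)
    - J.toFun x p.2 (flat g x q.1) r.2)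
  + K.toFun x ((flat g x).symm p.2) ((flat g x).symm q.2) ((flat g x).symm r.2)

theorem flat_dualVec (g : RMetric E M) (x : M) (Ψ : Cot E x →ₗ[ℝ] ℝ) (w : Tan E x) :
    flat g x (dualVec x Ψ) w = Ψ (flat g x w) := by
  rw [← apply_dualVec, flat_apply, flat_apply, g.symm]

theorem baseConn_fst (g : RMetric E M) (X : VField E M) (e' : Sec E M) (x : M) :
    baseConn g (X, 0) e' x = (leviCivita g e'.1 x (X x), leviCivitaForm g X e'.2 x) := rfl

theorem baseConn_snd [T2Space M] (g : RMetric E M) (ξ : OneForm E M) (e' : Sec E M) (x : M) :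
    baseConn g (0, ξ) e' x = 0 := by
  simp only [baseConn, leviCivitaForm_eq_flat, ContMDiffSection.coe_zero, Pi.zero_apply, map_zero]
  rfl

/-- The stated formulas for `∇_X` and `∇_ξ` together say that the difference from `∇⁰` is represented
by `tensorForm`. -/
theorem formula_iff [T2Space M] (g : RMetric E M) (H' : ThreeForm E M)
    (nabla : CourantConnection E M) (K : OneTwoForm E M) (J : OneTwoVector E M) :
    (∀ (X : VField E M) (ξ : OneForm E M) (Z : VField E M) (ζ : OneForm E M) (x : M),
          val (nabla.toFun (X, 0) (Z, ζ)) x =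
            ( leviCivita g Z x (X x)
                + (flat g x).symm (K.toFun x (X x) (Z x))
                - (1 / 3 : ℝ) • (flat g x).symm
                    (H'.toFun x (X x) ((flat g x).symm (ζ x)))
                - dualVec x (J.toFun x (flat g x (X x)) (ζ x)),
              - (1 / 3 : ℝ) • H'.toFun x (X x) (Z x)
                - flat g x (dualVec x
                    (J.toFun x (flat g x (X x)) (flat g x (Z x))))
                + leviCivitaForm g X ζ x
                + K.toFun x (X x) ((flat g x).symm (ζ x)) ) ∧
          val (nabla.toFun (0, ξ) (Z, ζ)) x =
            ( (1 / 6 : ℝ) • (flat g x).symm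
                  (H'.toFun x ((flat g x).symm (ξ x)) (Z x))
                - dualVec x (J.toFun x (ξ x) (flat g x (Z x)))
                + (flat g x).symm
                    (K.toFun x ((flat g x).symm (ξ x)) ((flat g x).symm (ζ x))),
              K.toFun x ((flat g x).symm (ξ x)) (Z x)
                + (1 / 6 : ℝ) • H'.toFun x ((flat g x).symm (ξ x))
                    ((flat g x).symm (ζ x))
                - flat g x (dualVec x (J.toFun x (ξ x) (ζ x))) )) ↔
    ∀ (e e' : Sec E M) (x : M) (r : Fib E x),
      pairing x (connDiff nabla g e e' x) r = tensorForm g H' K J x (val e x) (val e' x) r := by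
  have hs : ∀ x (α β : Cot E x), β ((flat g x).symm α) = α ((flat g x).symm β) :=
    fun x α β => flat_symm_apply_comm g x β α
  constructor
  · rintro h ⟨X, ξ⟩ ⟨Z, ζ⟩ x ⟨w, γ⟩
    obtain ⟨h1, h2⟩ := h X ξ Z ζ x
    have e : ((X, ξ) : Sec E M) = (X, 0) + (0, ξ) := by simp
    rw [e, connDiff_add_left, ← e, connDiff, connDiff, h1, h2]
    simp only [baseConn_fst, baseConn_snd, pairing_apply, map_add, map_sub,
      LinearMap.add_apply, LinearMap.sub_apply, sub_zero, add_apply, sub_apply,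
      smul_apply, map_smul, flat_dualVec, apply_dualVec, hs x _ γ, smul_eq_mul, tensorForm, val]
    ring
  · intro h X ξ Z ζ x
    have e1 : ∀ e e' : Sec E M, val (nabla.toFun e e') x =
        baseConn g e e' x + connDiff nabla g e e' x := fun e e' => by simp [connDiff]
    constructor <;>
    · rw [e1]
      refine eq_of_pairing_eq fun r => ?_
      rw [map_add, LinearMap.add_apply, h]
      simp only [baseConn_fst, baseConn_snd, pairing_apply, map_add, map_sub,
        add_apply, sub_apply, smul_apply, map_smul, flat_dualVec, apply_dualVec, hs x _ r.2,
        smul_eq_mul, map_zero, LinearMap.zero_apply, tensorForm, val, ContMDiffSection.coe_zero,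
        Pi.zero_apply, zero_apply]
      ring

/-! ### Extraction of the tensors `K` and `J` -/

/-- For a trilinear form that is skew in its last two arguments, the total skew-symmetrization is a
third of the cyclic sum. -/
theorem totalSkew_eq_zero_iff {V : Type*} {T : V → V → V → ℝ}
    (hT : ∀ u v w, T u v w = - T u w v) (u v w : V) :
    totalSkew T u v w = 0 ↔ T u v w + T v w u + T w u v = 0 := by
  rw [totalSkew, hT v u w, hT u w v, hT w v u]
  constructor <;> intro h <;> linarith

theorem ThreeForm.cyclic (H : ThreeForm E M) (x : M) (u v w : Tan E x) :
    H.toFun x v w u = H.toFun x u v w := by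
  rw [H.skew, H.skew', neg_neg]

section Extract
variable [T2Space M] (nabla : CourantConnection E M) (g : RMetric E M) (H : ThreeForm E M)

theorem diffForm_vvv (hT : IsTorsionFree nabla H) (x : M) (u v w : Tan E x) :
    diffForm nabla g x (u, 0) (v, 0) (w, 0) + diffForm nabla g x (v, 0) (w, 0) (u, 0)
      + diffForm nabla g x (w, 0) (u, 0) (v, 0) = - H.toFun x u v w :=
  diffForm_cyclic hT x (u, 0) (v, 0) (w, 0)

variable {g}

theorem diffForm_vff (hC : IsCompatible nabla g) (x : M) (p : Fib E x) (v w : Tan E x) :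
    diffForm nabla g x p (0, flat g x v) (0, flat g x w) =
      diffForm nabla g x p (v, 0) (w, 0) := by
  have h := diffForm_tau hC x p (0, flat g x v) (w, 0)
  simpa [tau] using h

theorem diffForm_fv (hC : IsCompatible nabla g) (x : M) (p : Fib E x) (v w : Tan E x) :
    diffForm nabla g x p (0, flat g x v) (w, 0) =
      diffForm nabla g x p (v, 0) (0, flat g x w) := by
  have h := diffForm_tau hC x p (v, 0) (w, 0)
  simpa [tau] using h.symm

variable {H}

/-- With `b(u, v, w) = ⟨A_u v, g w⟩` and `a(u, v, w) = ⟨A_{g u} v, w⟩`, where `A` is the difference from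
`∇⁰`, the cyclic identity gives `b(u, v, w) + b(v, w, u) + a(w, u, v) = 0` and makes the cyclic sum of
`a` vanish. Hence the cyclic sum of `b` vanishes as well, and `a = b`. -/
theorem diffForm_vvf_cyclic (hT : IsTorsionFree nabla H) (hC : IsCompatible nabla g) (x : M)
    (u v w : Tan E x) :
    diffForm nabla g x (u, 0) (v, 0) (0, flat g x w)
      + diffForm nabla g x (v, 0) (w, 0) (0, flat g x u)
      + diffForm nabla g x (w, 0) (u, 0) (0, flat g x v) = 0 ∧
    diffForm nabla g x (0, flat g x u) (v, 0) (w, 0) =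
      diffForm nabla g x (u, 0) (v, 0) (0, flat g x w) := by
  have a : ∀ u v w : Tan E x, diffForm nabla g x (u, 0) (v, 0) (0, flat g x w)
      + diffForm nabla g x (v, 0) (w, 0) (0, flat g x u)
      + diffForm nabla g x (0, flat g x w) (u, 0) (v, 0) = 0 := fun u v w => by
    have h := diffForm_cyclic (g := g) hT x (u, 0) (v, 0) (0, flat g x w)
    rw [diffForm_fv nabla hC] at h
    simpa using h
  have b : ∀ u v w : Tan E x, diffForm nabla g x (0, flat g x u) (v, 0) (w, 0)
      + diffForm nabla g x (0, flat g x v) (w, 0) (u, 0)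
      + diffForm nabla g x (0, flat g x w) (u, 0) (v, 0) = 0 := fun u v w => by
    have h := diffForm_cyclic (g := g) hT x (0, flat g x u) (0, flat g x v) (0, flat g x w)
    simp only [diffForm_vff nabla hC] at h
    simpa using h
  have h1 := a u v w
  have h2 := a v w u
  have h3 := a w u v
  have h4 := b u v w
  constructor <;> linarith

/-- With `a(u, v, w) = ⟨A_u v, w⟩` and `b(u, v, w) = ⟨A_{g u} g v, w⟩`, where `A` is the difference from
`∇⁰`, the cyclic identity gives `a(u, v, w) + b(v, w, u) + b(w, u, v) = 0` and the cyclic sum `-H` for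
`a`. Hence `b` has cyclic sum `H / 2`, and `a = b - H / 2`. -/
theorem diffForm_ffv_cyclic (hT : IsTorsionFree nabla H) (hC : IsCompatible nabla g) (x : M)
    (u v w : Tan E x) :
    diffForm nabla g x (0, flat g x u) (0, flat g x v) (w, 0)
      + diffForm nabla g x (0, flat g x v) (0, flat g x w) (u, 0)
      + diffForm nabla g x (0, flat g x w) (0, flat g x u) (v, 0) = 1 / 2 * H.toFun x u v w ∧
    diffForm nabla g x (u, 0) (v, 0) (w, 0) =
      diffForm nabla g x (0, flat g x u) (0, flat g x v) (w, 0) - 1 / 2 * H.toFun x u v w := by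
  have a : ∀ u v w : Tan E x, diffForm nabla g x (u, 0) (v, 0) (w, 0)
      + diffForm nabla g x (0, flat g x v) (0, flat g x w) (u, 0)
      + diffForm nabla g x (0, flat g x w) (0, flat g x u) (v, 0) = 0 := fun u v w => by
    have h := diffForm_cyclic (g := g) hT x (u, 0) (0, flat g x v) (0, flat g x w)
    rw [diffForm_vff nabla hC, ← diffForm_fv nabla hC] at h
    simpa using h
  have h1 := a u v w
  have h2 := a v w u
  have h3 := a w u v
  have h4 := diffForm_vvv nabla g H hT x u v w
  constructor <;> linarith

/-- The tensor `K(u, v, w) = ⟨∇_u v - ∇⁰_u v, g w⟩` of a Levi-Civita connection. Torsion-freeness is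
needed for smoothness, since it makes the difference tensorial; compatibility for skew-symmetry. -/
def extractK (hT : IsTorsionFree nabla H) (hC : IsCompatible nabla g) : OneTwoForm E M where
  toFun x := ((diffForm nabla g x).compl₁₂ (LinearMap.inl ℝ (Tan E x) (Cot E x))
    (LinearMap.inl ℝ (Tan E x) (Cot E x))).compr₂
    ((LinearMap.toContinuousLinearMap : (Tan E x →ₗ[ℝ] ℝ) ≃ₗ[ℝ] _).toLinearMap ∘ₗ
      LinearMap.lcomp ℝ ℝ (LinearMap.inr ℝ (Tan E x) (Cot E x) ∘ₗ (flat g x).toLinearMap))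
  skew x u v w := by
    change diffForm nabla g x (u, 0) (v, 0) (0, flat g x w) =
      - diffForm nabla g x (u, 0) (w, 0) (0, flat g x v)
    rw [← diffForm_fv nabla hC, diffForm_skew]
  smooth X Y Z := by
    have h : ∀ x, diffForm nabla g x (X x, 0) (Y x, 0) (0, flat g x (Z x)) =
        g.inner x ((nabla.toFun (X, 0) (Y, 0)).1 x) (Z x)
          - g.inner x (leviCivita g Y x (X x)) (Z x) := fun x => by
      have h' := DFunLike.congr_fun (diffForm_apply (g := g) hT (X, 0) (Y, 0) x)
        (0, flat g x (Z x))
      refine h'.trans ?_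
      simp [pairing_apply, connDiff, baseConn, val, flat_apply, g.symm x (Z x)]
    exact ((contMDiff_inner g _ Z).sub (contMDiff_inner_leviCivita g X Y Z)).congr h

theorem extractK_apply (hT : IsTorsionFree nabla H) (hC : IsCompatible nabla g) (x : M)
    (u v w : Tan E x) : (extractK nabla hT hC).toFun x u v w =
      diffForm nabla g x (u, 0) (v, 0) (0, flat g x w) := rfl

/-- The tensor `J(ξ, η, ζ) = H(g⁻¹ξ, g⁻¹η, g⁻¹ζ) / 6 - ⟨∇_ξ η, g⁻¹ζ⟩` of a Levi-Civita
connection. -/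
def extractJ (hT : IsTorsionFree nabla H) (hC : IsCompatible nabla g) : OneTwoVector E M where
  toFun x :=
    let A : Cot E x →ₗ[ℝ] Cot E x →ₗ[ℝ] Cot E x →ₗ[ℝ] ℝ :=
      ((H.toFun x).compl₁₂ (flat g x).symm.toLinearMap (flat g x).symm.toLinearMap).compr₂
        (LinearMap.lcomp ℝ ℝ (flat g x).symm.toLinearMap ∘ₗ ContinuousLinearMap.coeLM ℝ)
    let B : Cot E x →ₗ[ℝ] Cot E x →ₗ[ℝ] Cot E x →ₗ[ℝ] ℝ :=
      ((diffForm nabla g x).compl₁₂ (LinearMap.inr ℝ (Tan E x) (Cot E x))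
        (LinearMap.inr ℝ (Tan E x) (Cot E x))).compr₂
        (LinearMap.lcomp ℝ ℝ (LinearMap.inl ℝ (Tan E x) (Cot E x) ∘ₗ (flat g x).symm.toLinearMap))
    -- Instance search finds no subtraction on this iterated space of linear maps.
    (1 / 6 : ℝ) • A + (-1 : ℝ) • B
  skew x α β γ := by
    change 1 / 6 * H.toFun x ((flat g x).symm α) ((flat g x).symm β) ((flat g x).symm γ)
        + -1 * diffForm nabla g x (0, α) (0, β) ((flat g x).symm γ, 0) =
      - (1 / 6 * H.toFun x ((flat g x).symm α) ((flat g x).symm γ) ((flat g x).symm β)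
        + -1 * diffForm nabla g x (0, α) (0, γ) ((flat g x).symm β, 0))
    have h := diffForm_fv nabla hC x (0, α) ((flat g x).symm β) ((flat g x).symm γ)
    rw [LinearEquiv.apply_symm_apply, LinearEquiv.apply_symm_apply, diffForm_skew x _ (_, 0)] at h
    rw [H.skew, h]
    ring
  smooth ξ η ζ := by
    have h : ∀ x, 1 / 6 * H.toFun x (sharp g ξ x) (sharp g η x) (sharp g ζ x)
        + -1 * diffForm nabla g x (0, ξ x) (0, η x) (sharp g ζ x, 0) =
        1 / 6 * H.toFun x (sharp g ξ x) (sharp g η x) (sharp g ζ x)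
          - (nabla.toFun (0, ξ) (0, η)).2 x (sharp g ζ x) := fun x => by
      have h' := DFunLike.congr_fun (diffForm_apply (g := g) hT (0, ξ) (0, η) x)
        (sharp g ζ x, 0)
      rw [neg_one_mul, ← sub_eq_add_neg]
      refine congrArg _ (h'.trans ?_)
      simp [pairing_apply, connDiff, baseConn_snd, val]
    exact ((contMDiff_const.mul (H.smooth _ _ _)).sub (contMDiff_contr _ (sharp g ζ))).congr h

theorem extractJ_apply (hT : IsTorsionFree nabla H) (hC : IsCompatible nabla g) (x : M)
    (α β γ : Cot E x) : (extractJ nabla hT hC).toFun x α β γ =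
      1 / 6 * H.toFun x ((flat g x).symm α) ((flat g x).symm β) ((flat g x).symm γ)
      - diffForm nabla g x (0, α) (0, β) ((flat g x).symm γ, 0) := by
  rw [sub_eq_add_neg, ← neg_one_mul]
  rfl

theorem totalSkew_extractK (hT : IsTorsionFree nabla H) (hC : IsCompatible nabla g) (x : M)
    (u v w : Tan E x) :
    totalSkew (fun a b c => (extractK nabla hT hC).toFun x a b c) u v w = 0 := by
  rw [totalSkew_eq_zero_iff ((extractK nabla hT hC).skew x)]
  exact (diffForm_vvf_cyclic nabla hT hC x u v w).1

theorem totalSkew_extractJ (hT : IsTorsionFree nabla H) (hC : IsCompatible nabla g) (x : M)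
    (α β γ : Cot E x) :
    totalSkew (fun a b c => (extractJ nabla hT hC).toFun x a b c) α β γ = 0 := by
  rw [totalSkew_eq_zero_iff ((extractJ nabla hT hC).skew x)]
  have h := (diffForm_ffv_cyclic nabla hT hC x ((flat g x).symm α) ((flat g x).symm β)
    ((flat g x).symm γ)).1
  simp only [LinearEquiv.apply_symm_apply] at h
  simp only [extractJ_apply]
  rw [H.cyclic x ((flat g x).symm α), ← H.cyclic x ((flat g x).symm γ)]
  linarith

/-- Every component of the difference is one of four trilinear forms on `T_x M`, and these are
determined by `H`, `K` and `J`. -/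
theorem diffForm_eq_tensorForm (hT : IsTorsionFree nabla H) (hC : IsCompatible nabla g) (x : M)
    (p q r : Fib E x) : diffForm nabla g x p q r =
      tensorForm g H (extractK nabla hT hC) (extractJ nabla hT hC) x p q r := by
  obtain ⟨u, α⟩ := p
  obtain ⟨v, β⟩ := q
  obtain ⟨w, γ⟩ := r
  obtain ⟨u', rfl⟩ := (flat g x).surjective α
  obtain ⟨v', rfl⟩ := (flat g x).surjective β
  obtain ⟨w', rfl⟩ := (flat g x).surjective γ
  -- Split each argument into its vector and covector part, then reduce the eight components to the
  -- forms defining `K` and `J`.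
  have s : ∀ (a : Tan E x) (b : Cot E x), ((a, b) : Fib E x) = (a, 0) + (0, b) := by simp
  rw [s u, s v, s w]
  simp only [map_add, LinearMap.add_apply, tensorForm, extractK_apply, extractJ_apply,
    LinearEquiv.symm_apply_apply, diffForm_vff nabla hC, diffForm_fv nabla hC,
    (diffForm_vvf_cyclic nabla hT hC x _ _ _).2]
  simp only [← diffForm_fv nabla hC x (0, _), (diffForm_ffv_cyclic nabla hT hC x _ _ _).2]
  simp only [Prod.fst_add, Prod.snd_add, add_zero, zero_add, LinearEquiv.symm_apply_apply]
  ring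
end Extract

/-! ### The prescribed connection is Levi-Civita -/

section Converse
variable (g : RMetric E M) (H : ThreeForm E M) {K : OneTwoForm E M} {J : OneTwoVector E M}

/-- Skew-symmetry of the prescribed difference for `BlockDiag(g, g⁻¹)`. -/
theorem tensorForm_tau (K : OneTwoForm E M) (J : OneTwoVector E M) (x : M) (p q r : Fib E x) :
    tensorForm g H K J x p q (tau g x r) = - tensorForm g H K J x p r (tau g x q) := by
  simp only [tensorForm, tau, LinearEquiv.symm_apply_apply, LinearEquiv.apply_symm_apply]
  simp only [H.skew x _ r.1, H.skew x _ ((flat g x).symm r.2), K.skew x _ r.1,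
    K.skew x _ ((flat g x).symm r.2), J.skew x _ r.2, J.skew x _ (flat g x r.1)]
  ring

/-- The cyclic sum of each `K` and `J` term vanishes; the `H` terms add up to `-H` on three vectors and
to `(-1/3 + 1/6 + 1/6) H = 0` on one vector and two covectors. -/
theorem tensorForm_cyclic
    (hK : ∀ (x : M) (u v w : Tan E x), totalSkew (fun a b c => K.toFun x a b c) u v w = 0)
    (hJ : ∀ (x : M) (α β γ : Cot E x), totalSkew (fun a b c => J.toFun x a b c) α β γ = 0)
    (x : M) (p q r : Fib E x) :
    tensorForm g H K J x p q r + tensorForm g H K J x q r p + tensorForm g H K J x r p q =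
      - H.toFun x p.1 q.1 r.1 := by
  have k : ∀ u v w : Tan E x, K.toFun x w u v = - (K.toFun x u v w + K.toFun x v w u) :=
    fun u v w => by
      have := (totalSkew_eq_zero_iff (K.skew x) u v w).1 (hK x u v w)
      linarith
  have j : ∀ α β γ : Cot E x, J.toFun x γ α β = - (J.toFun x α β γ + J.toFun x β γ α) :=
    fun u v w => by
      have := (totalSkew_eq_zero_iff (J.skew x) u v w).1 (hJ x u v w)
      linarith
  simp only [tensorForm, k _ _ r.1, k _ _ ((flat g x).symm r.2), j _ _ r.2, j _ _ (flat g x r.1)]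
  have c : ∀ u v w : Tan E x, H.toFun x v w u = H.toFun x u v w ∧
      H.toFun x w u v = H.toFun x u v w :=
    fun u v w => ⟨H.cyclic x u v w, (H.cyclic x w u v).symm⟩
  generalize (flat g x).symm p.2 = u
  generalize (flat g x).symm q.2 = v
  generalize (flat g x).symm r.2 = w
  rw [(c p.1 q.1 r.1).1, (c p.1 q.1 r.1).2, (c p.1 v w).1, (c p.1 v w).2, (c u v r.1).1,
    (c u v r.1).2, (c u q.1 w).1, (c u q.1 w).2]
  ring
end Converse

end LeviCivitaConnections

end Courant

end

theorem mainTheorem4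
    {E : Type*} [NormedAddCommGroup E] [NormedSpace ℝ E] [FiniteDimensional ℝ E]
    {M : Type*} [TopologicalSpace M] [T2Space M] [ChartedSpace E M] [IsManifold 𝓘(ℝ, E) ∞ M]
    (g : Courant.RMetric E M) (H' : Courant.ThreeForm E M)
    (nabla : Courant.CourantConnection E M) :
    Courant.IsLeviCivita nabla H' g ↔
      ∃ (K : Courant.OneTwoForm E M) (J : Courant.OneTwoVector E M),
        (∀ (x : M) (u v w : Courant.Tan E x),
          Courant.totalSkew (fun a b c => K.toFun x a b c) u v w = 0) ∧
        (∀ (x : M) (α β γ : Courant.Cot E x),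
          Courant.totalSkew (fun a b c => J.toFun x a b c) α β γ = 0) ∧
        ∀ (X : Courant.VField E M) (ξ : Courant.OneForm E M)
          (Z : Courant.VField E M) (ζ : Courant.OneForm E M) (x : M),
          -- `∇_X (Z + ζ)`
          Courant.val (nabla.toFun (X, 0) (Z, ζ)) x =
            ( Courant.leviCivita g Z x (X x)
                + (Courant.flat g x).symm (K.toFun x (X x) (Z x))
                - (1 / 3 : ℝ) • (Courant.flat g x).symm
                    (H'.toFun x (X x) ((Courant.flat g x).symm (ζ x)))
                - Courant.dualVec x (J.toFun x (Courant.flat g x (X x)) (ζ x)),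
              - (1 / 3 : ℝ) • H'.toFun x (X x) (Z x)
                - Courant.flat g x (Courant.dualVec x
                    (J.toFun x (Courant.flat g x (X x)) (Courant.flat g x (Z x))))
                + Courant.leviCivitaForm g X ζ x
                + K.toFun x (X x) ((Courant.flat g x).symm (ζ x)) ) ∧
          -- `∇_ξ (Z + ζ)`
          Courant.val (nabla.toFun (0, ξ) (Z, ζ)) x =
            ( (1 / 6 : ℝ) • (Courant.flat g x).symm
                  (H'.toFun x ((Courant.flat g x).symm (ξ x)) (Z x))
                - Courant.dualVec x (J.toFun x (ξ x) (Courant.flat g x (Z x)))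
                + (Courant.flat g x).symm
                    (K.toFun x ((Courant.flat g x).symm (ξ x)) ((Courant.flat g x).symm (ζ x))),
              K.toFun x ((Courant.flat g x).symm (ξ x)) (Z x)
                + (1 / 6 : ℝ) • H'.toFun x ((Courant.flat g x).symm (ξ x))
                    ((Courant.flat g x).symm (ζ x))
                - Courant.flat g x (Courant.dualVec x (J.toFun x (ξ x) (ζ x))) ) := by
  constructor
  · rintro ⟨hT, hC⟩
    refine ⟨Courant.extractK nabla hT hC, Courant.extractJ nabla hT hC,
      Courant.totalSkew_extractK nabla hT hC, Courant.totalSkew_extractJ nabla hT hC,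
      (Courant.formula_iff g H' nabla _ _).2 fun e e' x r => ?_⟩
    rw [← Courant.diffForm_apply hT, Courant.diffForm_eq_tensorForm]
  · rintro ⟨K, J, hK, hJ, h⟩
    have h' := (Courant.formula_iff g H' nabla K J).1 h
    refine ⟨(Courant.isTorsionFree_iff nabla g H').2 fun x fr e e' j => ?_,
      (Courant.isCompatible_iff nabla g).2 fun e e' e'' x => ?_⟩
    · rw [h', h', h', Courant.tensorForm_cyclic g H' hK hJ]
      rfl
    · rw [h', h', Courant.tensorForm_tau]
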